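/- For every $z\in\mathbb C^k$ let $\Gamma_z$ be a closed cone of $(1,0)$-vectors at $z$ containing non-zero vectors, and assume that $\Gamma=\bigcup_{z}\Gamma_z$ is closed in $\mathbb C^k\times\mathbb C^k$. Let $\mathcal P_\Gamma$ be the cone of real functions $u\in\mathcal C^2(\mathbb C^k)$ with $\sum_{j,l}\frac{\partial^2u}{\partial z_j\partial\bar z_l}(z)\,\xi_j\bar\xi_l\ge 0$ for all $z\in\mathbb C^k$ and $\xi\in\Gamma_z$. For a compact set $K\subset\mathbb C^k$ put $\widehat K_\Gamma=\{z\in\mathbb C^k:\ u(z)\le\sup_K u\ \text{ for every } u\in\mathcal P_\Gamma\}$. A Jensen measure on $K$ representing $x$ for $\mathcal P_\Gamma$ is a probability measure $\mu_x$ carried by $K$ with $u(x)\le\int u\,d\mu_x$ for every $u\in\mathcal P_\Gamma$. A positive current $T$ of bidimension $(1,1)$ (which has order $0$, so that it acts on continuous $(1,1)$-forms with compact support) is called $\Gamma$-directed if $T\wedge i\partial\bar\partial u\ge 0$ for every $u\in\mathcal P_\Gamma$, i.e. $\langle T,\chi\, i\partial\bar\partial u\rangle\ge0$ for every non-negative test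 function $\chi$. **Theorem.** Let $K\subset\mathbb C^k$ be a compact set contained in an open ball $B$, let $x\in\widehat K_\Gamma$, and let $\mu_x$ be a Jensen measure on $K$ representing $x$ for $\mathcal P_\Gamma$. Then there is a positive $\Gamma$-directed current $T_x$ of bidimension $(1,1)$, with support in $\overline B$, such that $$i\partial\bar\partial T_x=\mu_x-\delta_x ,$$ that is, $\langle T_x,i\partial\bar\partial\varphi\rangle=\int\varphi\,d\mu_x-\varphi(x)$ for every test function $\varphi$. Moreover this current satisfies, for every $\varphi\in\mathcal P_\Gamma$, the Jensen formula $$\int\varphi\,d\mu_x=\varphi(x)+\langle T_x,i\partial\bar\partial\varphi\rangle ,$$ where $\langle T_x,i\partial\bar\partial\varphi\rangle:=\langle T_x,\chi\,i\partial\bar\partial\varphi\rangle$ for any test function $\chi$ equal to $1$ near the support of $T_x$. -/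

import Mathlib

open Set MeasureTheory Topology TopologicalSpace Complex Distributions
open scoped ContDiff ComplexOrder ComplexConjugate

noncomputable section

namespace GammaHull

/-- The space `ℂ^k` with its Euclidean norm. -/
abbrev Cn (k : ℕ) : Type := EuclideanSpace ℂ (Fin k)

/-- The standard basis vectors of `ℂ^k`. -/
def stdVec {k : ℕ} (j : Fin k) : Cn k := EuclideanSpace.single j (1 : ℂ)

/-- The Wirtinger derivative `∂f/∂z_j = (1/2) (∂f/∂x_j - i ∂f/∂y_j)`. -/
def dz {k : ℕ} (j : Fin k) (f : Cn k → ℂ) (z : Cn k) : ℂ :=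
  (1 / 2) * (fderiv ℝ f z (stdVec j) - I * fderiv ℝ f z (I • stdVec j))

/-- The Wirtinger derivative `∂f/∂z̄_j = (1/2) (∂f/∂x_j + i ∂f/∂y_j)`. -/
def dzbar {k : ℕ} (j : Fin k) (f : Cn k → ℂ) (z : Cn k) : ℂ :=
  (1 / 2) * (fderiv ℝ f z (stdVec j) + I * fderiv ℝ f z (I • stdVec j))

/-- A `(1,1)`-covector on `ℂ^k`, given by its coefficients: `a` stands for
`i ∑_{j,l} a_{jl} dz_j ∧ dz̄_l`. A `(1,1)`-form is a function `Cn k → Form11 k`. -/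
abbrev Form11 (k : ℕ) : Type := Fin k → Fin k → ℂ

/-- The value `∑_{j,l} a_{jl} ξ_j ξ̄_l` of the `(1,1)`-covector `i ∑ a_{jl} dz_j ∧ dz̄_l` on the
positive bivector defined by the `(1,0)`-vector `ξ = ∑ ξ_j ∂/∂z_j`. -/
def Form11.eval {k : ℕ} (a : Form11 k) (ξ : Cn k) : ℂ :=
  ∑ j, ∑ l, a j l * ξ j * conj (ξ l)

/-- The `(1,1)`-form `i∂∂̄f = i ∑ (∂²f/∂z_j∂z̄_l) dz_j ∧ dz̄_l`. -/
def ddbar {k : ℕ} (f : Cn k → ℂ) (z : Cn k) : Form11 k :=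
  fun j l => dz j (dzbar l f) z

/-- `i∂∂̄u` for a real function `u`. -/
abbrev ddbarR {k : ℕ} (u : Cn k → ℝ) : Cn k → Form11 k :=
  ddbar fun w => (u w : ℂ)

/-- A closed field of cones of `(1,0)`-vectors on `ℂ^k`: every `Γ_z` is a cone containing non-zero
vectors, and the union of the `Γ_z` is closed in the bundle `ℂ^k × ℂ^k` of `(1,0)`-vectors
(so that each `Γ_z` is closed as well). -/
structure ConeField (k : ℕ) where
  cone : Cn k → Set (Cn k)
  smul_mem : ∀ z, ∀ ξ ∈ cone z, ∀ t : ℝ, 0 < t → (t : ℂ) • ξ ∈ cone z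
  exists_ne_zero : ∀ z, ∃ ξ ∈ cone z, ξ ≠ 0
  isClosed_total : IsClosed {p : Cn k × Cn k | p.2 ∈ cone p.1}

/-- The cone `𝒫_Γ` of real `C²` functions on `ℂ^k` whose Levi form is non-negative on `Γ`. -/
def PSH {k : ℕ} (Γ : ConeField k) : Set (Cn k → ℝ) :=
  {u | ContDiff ℝ 2 u ∧ ∀ z, ∀ ξ ∈ Γ.cone z, 0 ≤ (ddbarR u z).eval ξ}

/-- The `𝒫_Γ`-hull of a compact set `K`. -/
def hull {k : ℕ} (Γ : ConeField k) (K : Set (Cn k)) : Set (Cn k) :=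
  {z | ∀ u ∈ PSH Γ, u z ≤ sSup (u '' K)}

/-- `μ` is a Jensen measure on the compact set `K` representing `x` with respect to `𝒫_Γ`: it is a
probability measure carried by `K` and `u(x) ≤ ∫ u dμ` for all `u ∈ 𝒫_Γ` (such `u` are continuous,
hence bounded on `K` and `μ`-integrable). -/
structure IsJensenMeasure {k : ℕ} (Γ : ConeField k) (K : Set (Cn k)) (x : Cn k)
    (μ : Measure (Cn k)) : Prop where
  isProbability : IsProbabilityMeasure μ
  carried : μ Kᶜ = 0
  le_integral : ∀ u ∈ PSH Γ, u x ≤ ∫ z, u z ∂μ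

section helpers

variable {k : ℕ}

theorem contDiff_dz {n m : WithTop ℕ∞} {f : Cn k → ℂ} (hf : ContDiff ℝ n f) (h : m + 1 ≤ n)
    (j : Fin k) : ContDiff ℝ m (dz j f) := by
  have h1 : ∀ v : Cn k, ContDiff ℝ m fun z => fderiv ℝ f z v := fun v =>
    (hf.fderiv_right h).clm_apply contDiff_const
  exact contDiff_const.mul ((h1 _).sub (contDiff_const.mul (h1 _)))

theorem contDiff_dzbar {n m : WithTop ℕ∞} {f : Cn k → ℂ} (hf : ContDiff ℝ n f) (h : m + 1 ≤ n)
    (j : Fin k) : ContDiff ℝ m (dzbar j f) := by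
  have h1 : ∀ v : Cn k, ContDiff ℝ m fun z => fderiv ℝ f z v := fun v =>
    (hf.fderiv_right h).clm_apply contDiff_const
  exact contDiff_const.mul ((h1 _).add (contDiff_const.mul (h1 _)))

theorem continuous_ddbar {f : Cn k → ℂ} (hf : ContDiff ℝ 2 f) : Continuous (ddbar f) := by
  refine continuous_pi fun j => continuous_pi fun l => ?_
  have h1 : ContDiff ℝ 1 (dzbar l f) := contDiff_dzbar hf (by norm_num) l
  exact (contDiff_dz (m := 0) h1 (by norm_num) j).continuous

theorem continuous_ddbarR {u : Cn k → ℝ} (hu : ContDiff ℝ 2 u) : Continuous (ddbarR u) :=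
  continuous_ddbar (ofRealCLM.contDiff.comp hu)

theorem fderiv_eq_zero_off {f : Cn k → ℂ} {z : Cn k} (hz : z ∉ tsupport f) : fderiv ℝ f z = 0 := by
  by_contra h
  exact hz (support_fderiv_subset ℝ h)

theorem tsupport_ddbar_subset (f : Cn k → ℂ) : tsupport (ddbar f) ⊆ tsupport f := by
  refine closure_minimal (fun z hz => ?_) (isClosed_tsupport f)
  by_contra hzf
  apply hz
  funext j l
  have h2 : z ∉ tsupport (dzbar l f) := by
    refine fun h => hzf (closure_minimal (fun w hw => ?_) (isClosed_tsupport f) h)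
    by_contra hwf
    exact hw (by simp [dzbar, fderiv_eq_zero_off hwf])
  simp [ddbar, dz, fderiv_eq_zero_off h2]

theorem hasCompactSupport_ddbar {f : Cn k → ℂ} (hf : HasCompactSupport f) :
    HasCompactSupport (ddbar f) :=
  IsCompact.of_isClosed_subset hf (isClosed_tsupport _) (tsupport_ddbar_subset f)

end helpers

/-- A current of bidimension `(1,1)` on `ℂ^k`, of order zero: a continuous linear functional on the
space of continuous `(1,1)`-forms with compact support. Positive currents are always of this
kind, since they have measure coefficients; this is what gives a meaning to `T ∧ i∂∂̄u` for functions
`u` which are only of class `C²`. -/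
abbrev Current (k : ℕ) : Type := 𝓓^{0}((⊤ : Opens (Cn k)), Form11 k) →L[ℂ] ℂ

/-- `i∂∂̄φ` as a test form, for a test function `φ`. -/
def ddbarTest {k : ℕ} (φ : 𝓓((⊤ : Opens (Cn k)), ℂ)) : 𝓓^{0}((⊤ : Opens (Cn k)), Form11 k) where
  toFun := ddbar φ
  contDiff' := contDiff_zero.2 (continuous_ddbar (φ.contDiff.of_le (WithTop.coe_le_coe.2 (le_top : (2 : ℕ∞) ≤ ⊤))))
  hasCompactSupport' := hasCompactSupport_ddbar φ.hasCompactSupport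
  tsupport_subset' := fun _ _ => trivial

/-- The test form `χψ`, for a test function `χ` and a continuous `(1,1)`-form `ψ`. -/
def cutoff {k : ℕ} (χ : 𝓓((⊤ : Opens (Cn k)), ℝ)) (ψ : Cn k → Form11 k) (hψ : Continuous ψ) :
    𝓓^{0}((⊤ : Opens (Cn k)), Form11 k) where
  toFun := fun z => χ z • ψ z
  contDiff' := contDiff_zero.2 (χ.continuous.smul hψ)
  hasCompactSupport' := χ.hasCompactSupport.smul_right
  tsupport_subset' := fun _ _ => trivial

namespace Current

variable {k : ℕ}

/-- The current `i∂∂̄T` of bidimension `(0,0)`: `⟨i∂∂̄T, φ⟩ = ⟨T, i∂∂̄φ⟩`. -/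
def iddbar (T : Current k) (φ : 𝓓((⊤ : Opens (Cn k)), ℂ)) : ℂ := T (ddbarTest φ)

/-- `T ≥ 0`: `T` is non-negative on the positive test `(1,1)`-forms. -/
def IsPositive (T : Current k) : Prop :=
  ∀ ψ : 𝓓^{0}((⊤ : Opens (Cn k)), Form11 k), (∀ z ξ, 0 ≤ (ψ z).eval ξ) → 0 ≤ T ψ

/-- `T` is a `Γ`-directed positive current: `T ≥ 0` and `T ∧ i∂∂̄u` is a positive distribution for
every `u ∈ 𝒫_Γ`, where `⟨T ∧ i∂∂̄u, χ⟩ = ⟨T, χ i∂∂̄u⟩`. -/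
def IsDirected (T : Current k) (Γ : ConeField k) : Prop :=
  T.IsPositive ∧ ∀ (u : Cn k → ℝ) (hu : u ∈ PSH Γ) (χ : 𝓓((⊤ : Opens (Cn k)), ℝ)),
    (∀ z, 0 ≤ χ z) → 0 ≤ T (cutoff χ (ddbarR u) (continuous_ddbarR hu.1))

/-- `⟨T, ψ⟩ = c`, for a current `T` with compact support and a continuous `(1,1)`-form `ψ`, not
necessarily with compact support: `⟨T, χψ⟩ = c` for all test functions `χ` equal to `1` near the
support of `T`. -/
def HasPairing (T : Current k) (ψ : Cn k → Form11 k) (hψ : Continuous ψ) (c : ℂ) : Prop :=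
  IsCompact (Distribution.dsupport T) ∧
    ∀ χ : 𝓓((⊤ : Opens (Cn k)), ℝ), (∀ᶠ z in 𝓝ˢ (Distribution.dsupport T), χ z = 1) →
      T (cutoff χ ψ hψ) = c

end Current

end GammaHull

end

/-!
The current is built as an average of point evaluations `ψ ↦ ⟨ψ(z), ξ⟩` over the compact set of unit
vectors `ξ ∈ Γ_z` with `z` in the closed ball. For a real function `u` of class `C²`, the value of
`i∂∂̄u` on `ξ` is the Levi form of `u` (`eval_ddbarR`); so one looks for a positive linear form `Λ` on
the continuous functions on these unit vectors with `Λ(Levi form of u) = ∫ u dμ - u(x)` for all `u`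
of class `C²`. The Levi form of `‖z - a‖²` is the constant `1` on unit vectors, and the M. Riesz
extension theorem (`exists_positive_extension`) provides `Λ` once it is known that the right-hand
side is non-negative whenever the Levi form of `u` is non-negative on `Γ` over the closed ball.

This is the Jensen inequality, except that `u` is `Γ`-plurisubharmonic only over the ball. But `K`
lies in a smaller closed ball, and so does `x`, because `‖z - a‖²` belongs to `𝒫_Γ`. The function `u`
agrees on that smaller ball with an element of `𝒫_Γ`: multiply `u` by a cutoff function and add a
large multiple of `((‖z - a‖² - s²)⁺)³`, which vanishes on the ball of radius `s` and whose Levi form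
dominates `‖ξ‖²` away from it (`exists_mem_PSH_eqOn_closedBall`).

The complexification of `Λ` applied to `(z, ξ) ↦ ⟨ψ(z), ξ⟩` is a current of order zero. Positivity,
directedness and the location of the support are immediate, since only the values of `ψ` on vectors
of `Γ` over the closed ball matter. The Jensen formula for a function of class `C²` is the defining
property of `Λ` for a cutoff function equal to `1` near the closed ball; a cutoff function equal to
`1` merely near the support gives the same value, because a distribution of order zero vanishes on
test functions supported off its support (`isVanishingOn_compl_dsupport`).
-/

noncomputable section

namespace GammaHull

/-! ### The Levi form -/

section Levi

variable {k : ℕ} {F : Type*} [NormedAddCommGroup F] [NormedSpace ℝ F]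

/-- The Levi form of `f` at `z` in the direction `ξ`, as a quarter of the Laplacian of `f` on the
complex line `z + ℂ ξ`. It is expressed by the real second derivative, so that it makes sense for
functions with values in any real normed space. -/
def leviForm (f : Cn k → F) (z ξ : Cn k) : F :=
  (1 / 4 : ℝ) • (fderiv ℝ (fderiv ℝ f) z ξ ξ + fderiv ℝ (fderiv ℝ f) z (I • ξ) (I • ξ))

theorem sum_stdVec (ξ : Cn k) : ∑ j, ξ j • stdVec j = ξ := by
  ext i
  simp [stdVec, Pi.single_apply]

theorem map_complex_smul (A : Cn k →L[ℝ] ℂ) (c : ℂ) (v : Cn k) :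
    A (c • v) = c.re * A v + c.im * A (I • v) := by
  have h : c • v = c.re • v + c.im • (I • v) := by
    conv_lhs => rw [← re_add_im c]
    rw [add_smul, mul_smul]
    rfl
  rw [h, map_add, map_smul, map_smul, real_smul, real_smul]

/-- The complex-linear part of a real-linear form, up to a factor `2`, in coordinates. -/
theorem sum_linear_part (A : Cn k →L[ℝ] ℂ) (ξ : Cn k) :
    ∑ j, (A (stdVec j) - I * A (I • stdVec j)) * ξ j = A ξ - I * A (I • ξ) := by
  conv_rhs => rw [← sum_stdVec ξ]
  simp only [Finset.smul_sum, map_sum, Finset.mul_sum, ← Finset.sum_sub_distrib, smul_smul]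
  refine Finset.sum_congr rfl fun j _ => ?_
  rw [map_complex_smul A (ξ j), map_complex_smul A (I * ξ j), I_mul_re, I_mul_im, ofReal_neg]
  linear_combination (-(ξ j).im * A (I • stdVec j)) * I_sq -
    (A (stdVec j) - I * A (I • stdVec j)) * re_add_im (ξ j)

/-- The complex-antilinear part of a real-linear form, up to a factor `2`, in coordinates. -/
theorem sum_antilinear_part (A : Cn k →L[ℝ] ℂ) (ξ : Cn k) :
    ∑ j, (A (stdVec j) + I * A (I • stdVec j)) * conj (ξ j) = A ξ + I * A (I • ξ) := by
  conv_rhs => rw [← sum_stdVec ξ]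
  simp only [Finset.smul_sum, map_sum, Finset.mul_sum, ← Finset.sum_add_distrib, smul_smul]
  refine Finset.sum_congr rfl fun j _ => ?_
  have hconj : conj (ξ j) = (ξ j).re - (ξ j).im * I := by
    rw [← re_add_im (conj (ξ j)), conj_re, conj_im, ofReal_neg]
    ring
  rw [map_complex_smul A (ξ j), map_complex_smul A (I * ξ j), I_mul_re, I_mul_im, ofReal_neg]
  linear_combination (-(ξ j).im * A (I • stdVec j)) * I_sq +
    (A (stdVec j) + I * A (I • stdVec j)) * hconj

theorem differentiable_fderiv_of_contDiff {f : Cn k → F} (hf : ContDiff ℝ 2 f) :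
    Differentiable ℝ (fderiv ℝ f) :=
  (hf.fderiv_right (m := 1) (by norm_num)).differentiable (by norm_num)

theorem fderiv_dzbar {f : Cn k → ℂ} (hf : ContDiff ℝ 2 f) (l : Fin k) (z v : Cn k) :
    fderiv ℝ (dzbar l f) z v = (1 / 2) * (fderiv ℝ (fderiv ℝ f) z v (stdVec l) +
      I * fderiv ℝ (fderiv ℝ f) z v (I • stdVec l)) := by
  have h := (differentiable_fderiv_of_contDiff hf z).hasFDerivAt
  have h1 : ∀ w : Cn k, HasFDerivAt (fun z => fderiv ℝ f z w)
      ((fderiv ℝ (fderiv ℝ f) z).flip w) z := fun w => by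
    simpa using h.clm_apply (hasFDerivAt_const w z)
  have h2 : HasFDerivAt (dzbar l f) _ z :=
    ((h1 (stdVec l)).add ((h1 (I • stdVec l)).const_mul I)).const_mul (1 / 2)
  rw [h2.fderiv]
  simp [mul_add]

/-- The value of `i∂∂̄f` on `ξ` is the Levi form of `f`: the mixed terms `D²f(ξ, iξ)` and `D²f(iξ, ξ)`
cancel because second derivatives are symmetric. -/
theorem eval_ddbar {f : Cn k → ℂ} (hf : ContDiff ℝ 2 f) (z ξ : Cn k) :
    (ddbar f z).eval ξ = leviForm f z ξ := by
  have hsymm : fderiv ℝ (fderiv ℝ f) z (I • ξ) ξ = fderiv ℝ (fderiv ℝ f) z ξ (I • ξ) :=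
    (hf.contDiffAt.isSymmSndFDerivAt (by simp)).eq _ _
  have h1 : ∀ j l, ddbar f z j l * ξ j * conj (ξ l) = (1 / 4) * (
      ((fderiv ℝ (fderiv ℝ f) z (stdVec j) (stdVec l) +
        I * fderiv ℝ (fderiv ℝ f) z (stdVec j) (I • stdVec l)) * conj (ξ l)) -
      I * ((fderiv ℝ (fderiv ℝ f) z (I • stdVec j) (stdVec l) +
        I * fderiv ℝ (fderiv ℝ f) z (I • stdVec j) (I • stdVec l)) * conj (ξ l))) * ξ j := by
    intro j l
    simp only [ddbar, dz, fderiv_dzbar hf]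
    ring
  simp only [Form11.eval, h1, ← Finset.sum_mul, ← Finset.mul_sum, Finset.sum_sub_distrib,
    sum_antilinear_part]
  have h2 := sum_linear_part ((fderiv ℝ (fderiv ℝ f) z).flip ξ +
    I • (fderiv ℝ (fderiv ℝ f) z).flip (I • ξ)) ξ
  simp only [add_apply, smul_apply,
    ContinuousLinearMap.flip_apply, smul_eq_mul, hsymm] at h2
  simp only [mul_assoc, ← Finset.mul_sum, h2, leviForm, real_smul]
  push_cast
  linear_combination (-(1 / 4) * fderiv ℝ (fderiv ℝ f) z (I • ξ) (I • ξ)) * I_sq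

theorem leviForm_comp_clm {G : Type*} [NormedAddCommGroup G] [NormedSpace ℝ G] (A : F →L[ℝ] G)
    {f : Cn k → F} (hf : ContDiff ℝ 2 f) (z ξ : Cn k) :
    leviForm (fun w => A (f w)) z ξ = A (leviForm f z ξ) := by
  have h1 : fderiv ℝ (fun w => A (f w)) = fun w => A.comp (fderiv ℝ f w) := by
    funext w
    exact (A.hasFDerivAt.comp w (hf.differentiable (by norm_num) w).hasFDerivAt).fderiv
  have h2 : ∀ v w, fderiv ℝ (fderiv ℝ fun w => A (f w)) z v w
      = A (fderiv ℝ (fderiv ℝ f) z v w) := by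
    intro v w
    have h3 : HasFDerivAt (fun w => A.comp (fderiv ℝ f w)) _ z :=
      (ContinuousLinearMap.compL ℝ (Cn k) F G A).hasFDerivAt.comp z
        (differentiable_fderiv_of_contDiff hf z).hasFDerivAt
    rw [h1, h3.fderiv]
    rfl
  simp [leviForm, h2]

theorem eval_ddbarR {u : Cn k → ℝ} (hu : ContDiff ℝ 2 u) (z ξ : Cn k) :
    (ddbarR u z).eval ξ = ((leviForm u z ξ : ℝ) : ℂ) :=
  (eval_ddbar (ofRealCLM.contDiff.comp hu) z ξ).trans (leviForm_comp_clm ofRealCLM hu z ξ)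

theorem mem_PSH_iff {Γ : ConeField k} {u : Cn k → ℝ} :
    u ∈ PSH Γ ↔ ContDiff ℝ 2 u ∧ ∀ z, ∀ ξ ∈ Γ.cone z, 0 ≤ leviForm u z ξ := by
  refine and_congr_right fun hu => ?_
  simp [eval_ddbarR hu]

theorem leviForm_add {f g : Cn k → F} (hf : ContDiff ℝ 2 f) (hg : ContDiff ℝ 2 g) (z ξ : Cn k) :
    leviForm (f + g) z ξ = leviForm f z ξ + leviForm g z ξ := by
  have h1 : fderiv ℝ (f + g) = fderiv ℝ f + fderiv ℝ g := by
    funext w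
    exact fderiv_add (hf.differentiable (by norm_num) w) (hg.differentiable (by norm_num) w)
  rw [leviForm, h1, fderiv_add (differentiable_fderiv_of_contDiff hf z)
    (differentiable_fderiv_of_contDiff hg z)]
  simp only [add_apply, leviForm]
  module

theorem leviForm_const_smul (c : ℝ) {f : Cn k → F} (hf : ContDiff ℝ 2 f) (z ξ : Cn k) :
    leviForm (c • f) z ξ = c • leviForm f z ξ :=
  leviForm_comp_clm (c • ContinuousLinearMap.id ℝ F) hf z ξ

theorem continuous_leviForm {f : Cn k → F} (hf : ContDiff ℝ 2 f) :
    Continuous fun p : Cn k × Cn k => leviForm f p.1 p.2 := by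
  have h : Continuous (fderiv ℝ (fderiv ℝ f)) :=
    (hf.fderiv_right (m := 1) (by norm_num)).continuous_fderiv (by norm_num)
  have h' : Continuous fun p : Cn k × Cn k => fderiv ℝ (fderiv ℝ f) p.1 := h.comp continuous_fst
  unfold leviForm
  fun_prop

theorem norm_leviForm_le (f : Cn k → F) (z ξ : Cn k) :
    ‖leviForm f z ξ‖ ≤ ‖fderiv ℝ (fderiv ℝ f) z‖ * ‖ξ‖ ^ 2 := by
  have h : ∀ v : Cn k, ‖v‖ = ‖ξ‖ → ‖fderiv ℝ (fderiv ℝ f) z v v‖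
      ≤ ‖fderiv ℝ (fderiv ℝ f) z‖ * ‖ξ‖ ^ 2 := fun v hv => by
    refine (ContinuousLinearMap.le_opNorm₂ _ _ _).trans_eq ?_
    rw [hv]
    ring
  have h1 := h ξ rfl
  have h2 := h (I • ξ) (by simp [norm_smul])
  have h3 := norm_add_le (fderiv ℝ (fderiv ℝ f) z ξ ξ) (fderiv ℝ (fderiv ℝ f) z (I • ξ) (I • ξ))
  have h4 : 0 ≤ ‖fderiv ℝ (fderiv ℝ f) z‖ * ‖ξ‖ ^ 2 := by positivity
  rw [leviForm, norm_smul, Real.norm_of_nonneg (by norm_num)]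
  linarith

theorem leviForm_congr {f g : Cn k → F} {z : Cn k} (h : f =ᶠ[𝓝 z] g) (ξ : Cn k) :
    leviForm f z ξ = leviForm g z ξ := by
  rw [leviForm, leviForm, h.fderiv.fderiv_eq]

/-- The second order chain rule for the Levi form. -/
theorem leviForm_comp_real {h h' h'' : ℝ → ℝ} (hh : ∀ t, HasDerivAt h (h' t) t)
    (hh' : ∀ t, HasDerivAt h' (h'' t) t) {q : Cn k → ℝ} (hq : ContDiff ℝ 2 q) (z ξ : Cn k) :
    leviForm (fun w => h (q w)) z ξ = h' (q z) * leviForm q z ξ +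
      h'' (q z) / 4 * (fderiv ℝ q z ξ ^ 2 + fderiv ℝ q z (I • ξ) ^ 2) := by
  have hq1 : ∀ w, HasFDerivAt q (fderiv ℝ q w) w := fun w =>
    (hq.differentiable (by norm_num) w).hasFDerivAt
  have h1 : fderiv ℝ (fun w => h (q w)) = fun w => h' (q w) • fderiv ℝ q w := by
    funext w
    exact ((hh (q w)).comp_hasFDerivAt w (hq1 w)).fderiv
  have h2 : HasFDerivAt (fun w => h' (q w) • fderiv ℝ q w) _ z :=
    ((hh' (q z)).comp_hasFDerivAt z (hq1 z)).smul
      (differentiable_fderiv_of_contDiff hq z).hasFDerivAt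
  rw [leviForm, h1, h2.fderiv]
  simp [leviForm]
  ring

/-- `z ↦ ‖z - a‖²` has the Levi form `‖ξ‖²`. -/
theorem leviForm_norm_sub_sq (a z ξ : Cn k) :
    leviForm (fun w : Cn k => ‖w - a‖ ^ 2) z ξ = ‖ξ‖ ^ 2 := by
  have h1 : fderiv ℝ (fun w : Cn k => ‖w - a‖ ^ 2) = fun w => 2 • innerSL ℝ (w - a) := by
    funext w
    simpa using ((hasFDerivAt_id w).sub_const a).norm_sq.fderiv
  have h2 : HasFDerivAt (fun w : Cn k => 2 • innerSL ℝ (w - a)) (2 • innerSL ℝ) z :=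
    (((innerSL ℝ (E := Cn k)).hasFDerivAt (x := z - a)).comp z
      ((hasFDerivAt_id z).sub_const a)).const_smul (2 : ℕ)
  rw [leviForm, h1, h2.fderiv]
  have h3 : ∀ v : Cn k, innerSL ℝ v v = ‖v‖ ^ 2 := fun v => real_inner_self_eq_norm_sq v
  simp [h3, norm_smul]
  ring

theorem contDiff_norm_sub_sq (a : Cn k) {n : WithTop ℕ∞} :
    ContDiff ℝ n fun w : Cn k => ‖w - a‖ ^ 2 :=
  (contDiff_id.sub contDiff_const).norm_sq ℝ

end Levi

/-! ### Extension of directed plurisubharmonic functions -/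

theorem hasDerivAt_max_pow (n : ℕ) (t : ℝ) :
    HasDerivAt (fun t : ℝ => max t 0 ^ (n + 2)) ((n + 2) * max t 0 ^ (n + 1)) t := by
  rcases lt_trichotomy t 0 with ht | rfl | ht
  · rw [max_eq_right ht.le, zero_pow (by omega), mul_zero]
    refine (hasDerivAt_const t (0 : ℝ)).congr_of_eventuallyEq ?_
    filter_upwards [gt_mem_nhds ht] with y hy
    simp [max_eq_right hy.le]
  · have h : (fun t : ℝ => max t 0 ^ (n + 2)) =O[𝓝 0] fun t => ‖t - 0‖ ^ (n + 2) := by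
      refine Asymptotics.IsBigO.of_bound 1 (Filter.Eventually.of_forall fun y => ?_)
      have h1 : max y 0 ≤ ‖y‖ := max_le (le_abs_self y) (norm_nonneg y)
      have h2 : 0 ≤ max y 0 := le_max_right _ _
      simpa [abs_of_nonneg h2] using pow_le_pow_left₀ h2 h1 (n + 2)
    simpa [hasDerivAt_iff_hasFDerivAt] using h.hasFDerivAt (by omega)
  · rw [max_eq_left ht.le]
    have h := hasDerivAt_pow (n + 2) t
    simp only [Nat.add_succ_sub_one] at h
    push_cast at h
    refine h.congr_of_eventuallyEq ?_
    filter_upwards [lt_mem_nhds ht] with y hy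
    simp [max_eq_left hy.le]

section Barrier

variable {k : ℕ}

/-- The function `((‖z - a‖² - s²)⁺)³`. It is of class `C²`; for `s ≥ 0` it vanishes exactly on the
closed ball of radius `s`, and it is strictly plurisubharmonic outside that ball. -/
def barrier (a : Cn k) (s : ℝ) (z : Cn k) : ℝ := max (‖z - a‖ ^ 2 - s ^ 2) 0 ^ 3

theorem contDiff_barrier (a : Cn k) (s : ℝ) : ContDiff ℝ 2 (barrier a s) := by
  have h1 : ContDiff ℝ 1 fun t : ℝ => max t 0 ^ 2 := by
    rw [contDiff_one_iff_deriv]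
    refine ⟨fun t => (hasDerivAt_max_pow 0 t).differentiableAt, ?_⟩
    rw [funext fun t => (hasDerivAt_max_pow 0 t).deriv]
    fun_prop
  have h2 : ContDiff ℝ 2 fun t : ℝ => max t 0 ^ 3 := by
    rw [show (2 : WithTop ℕ∞) = 1 + 1 by norm_num, contDiff_succ_iff_deriv]
    refine ⟨fun t => (hasDerivAt_max_pow 1 t).differentiableAt, by simp, ?_⟩
    rw [funext fun t => (hasDerivAt_max_pow 1 t).deriv]
    exact contDiff_const.mul h1
  exact h2.comp ((contDiff_norm_sub_sq a).sub contDiff_const)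

theorem barrier_eq_zero {a z : Cn k} {s : ℝ} (hz : z ∈ Metric.closedBall a s) :
    barrier a s z = 0 := by
  rw [mem_closedBall_iff_norm] at hz
  have h : ‖z - a‖ ^ 2 - s ^ 2 ≤ 0 := sub_nonpos.2 (pow_le_pow_left₀ (norm_nonneg _) hz 2)
  simp [barrier, max_eq_right h]

theorem le_leviForm_barrier (a : Cn k) (s : ℝ) (z ξ : Cn k) :
    3 * max (‖z - a‖ ^ 2 - s ^ 2) 0 ^ 2 * ‖ξ‖ ^ 2 ≤ leviForm (barrier a s) z ξ := by
  have h1 : ∀ t, HasDerivAt (fun t => max (t - s ^ 2) 0 ^ 3) (3 * max (t - s ^ 2) 0 ^ 2) t :=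
    fun t => by
      have h := (hasDerivAt_max_pow 1 (t - s ^ 2)).comp_sub_const t (s ^ 2)
      norm_num at h
      exact h
  have h2 : ∀ t, HasDerivAt (fun t => 3 * max (t - s ^ 2) 0 ^ 2) (6 * max (t - s ^ 2) 0) t :=
    fun t => by
      have h := ((hasDerivAt_max_pow 0 (t - s ^ 2)).comp_sub_const t (s ^ 2)).const_mul 3
      norm_num [← mul_assoc] at h
      exact h
  have h3 := leviForm_comp_real h1 h2 (contDiff_norm_sub_sq a) z ξ
  rw [leviForm_norm_sub_sq] at h3
  have h4 : 0 ≤ max (‖z - a‖ ^ 2 - s ^ 2) 0 := le_max_right _ _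
  rw [show barrier a s = fun w => max (‖w - a‖ ^ 2 - s ^ 2) 0 ^ 3 from rfl, h3]
  exact le_add_of_nonneg_right (by positivity)

theorem exists_leviForm_barrier_ge (a : Cn k) {s t : ℝ} (hs : 0 ≤ s) (hst : s < t) (M : ℝ)
    (hM : 0 ≤ M) : ∃ C : ℝ, 0 ≤ C ∧
      ∀ z ξ, t ≤ ‖z - a‖ → M * ‖ξ‖ ^ 2 ≤ C * leviForm (barrier a s) z ξ := by
  obtain ⟨δ, hδ_def⟩ : ∃ δ, δ = t ^ 2 - s ^ 2 := ⟨_, rfl⟩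
  have hδ : 0 < δ := hδ_def ▸ sub_pos.2 (pow_lt_pow_left₀ hst hs (by norm_num))
  refine ⟨M / (3 * δ ^ 2), by positivity, fun z ξ hz => ?_⟩
  have h2 : δ ≤ max (‖z - a‖ ^ 2 - s ^ 2) 0 := by
    have h3 : t ^ 2 ≤ ‖z - a‖ ^ 2 := pow_le_pow_left₀ (hs.trans hst.le) hz 2
    exact le_max_of_le_left (by linarith)
  calc M * ‖ξ‖ ^ 2 = M / (3 * δ ^ 2) * (3 * δ ^ 2 * ‖ξ‖ ^ 2) := by field_simp
    _ ≤ M / (3 * δ ^ 2) * (3 * max (‖z - a‖ ^ 2 - s ^ 2) 0 ^ 2 * ‖ξ‖ ^ 2) := by gcongr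
    _ ≤ _ := mul_le_mul_of_nonneg_left (le_leviForm_barrier a s z ξ) (by positivity)

theorem exists_norm_fderiv_fderiv_le {E F : Type*} [NormedAddCommGroup E] [NormedSpace ℝ E]
    [NormedAddCommGroup F] [NormedSpace ℝ F] {v : E → F} (hv : ContDiff ℝ 2 v)
    (hvc : HasCompactSupport v) : ∃ M : ℝ, ∀ z, ‖fderiv ℝ (fderiv ℝ v) z‖ ≤ M :=
  ((hv.fderiv_right (m := 1) (by norm_num)).continuous_fderiv
    (by norm_num)).bounded_above_of_compact_support ((hvc.fderiv (𝕜 := ℝ)).fderiv (𝕜 := ℝ))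

theorem exists_abs_leviForm_le {v : Cn k → ℝ} (hv : ContDiff ℝ 2 v) (hvc : HasCompactSupport v) :
    ∃ M : ℝ, 0 ≤ M ∧ ∀ z ξ, |leviForm v z ξ| ≤ M * ‖ξ‖ ^ 2 := by
  obtain ⟨M, hM⟩ := exists_norm_fderiv_fderiv_le hv hvc
  exact ⟨M, (norm_nonneg (fderiv ℝ (fderiv ℝ v) 0)).trans (hM 0), fun z ξ => (norm_leviForm_le v z ξ).trans
    (mul_le_mul_of_nonneg_right (hM z) (by positivity))⟩

/-- A function whose Levi form is non-negative on `Γ` over the ball of radius `r` agrees on every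
smaller ball with an element of `𝒫_Γ`: cut the function off, and compensate the negative part of the
Levi form of the result by a large multiple of a barrier that vanishes on the smaller ball. -/
theorem exists_mem_PSH_eqOn_closedBall (Γ : ConeField k) (a : Cn k) {s r : ℝ} (hs : 0 ≤ s)
    (hsr : s < r) {φ : Cn k → ℝ} (hφ : ContDiff ℝ 2 φ)
    (hφΓ : ∀ z ∈ Metric.closedBall a r, ∀ ξ ∈ Γ.cone z, 0 ≤ leviForm φ z ξ) :
    ∃ u ∈ PSH Γ, EqOn u φ (Metric.closedBall a s) := by
  obtain ⟨t, hst, htr⟩ := exists_between hsr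
  obtain ⟨χ, hχ, hχc, hχ1⟩ : ∃ χ : Cn k → ℝ, ContDiff ℝ 2 χ ∧ HasCompactSupport χ ∧
      EqOn χ 1 (Metric.closedBall a t) :=
    let b : ContDiffBump a := ⟨t, r, hs.trans_lt hst, htr⟩
    ⟨b, b.contDiff, b.hasCompactSupport, fun z hz => b.one_of_mem_closedBall hz⟩
  have hv : ContDiff ℝ 2 (χ • φ) := hχ.smul hφ
  obtain ⟨M, hM0, hM⟩ := exists_abs_leviForm_le hv hχc.smul_right
  obtain ⟨C, hC0, hC⟩ := exists_leviForm_barrier_ge a hs hst M hM0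
  have hb : ContDiff ℝ 2 (C • barrier a s) := (contDiff_barrier a s).const_smul C
  refine ⟨χ • φ + C • barrier a s, mem_PSH_iff.2 ⟨hv.add hb, fun z ξ hξ => ?_⟩, fun z hz => ?_⟩
  · rw [leviForm_add hv hb, leviForm_const_smul C (contDiff_barrier a s), smul_eq_mul (a := C)]
    rcases lt_or_ge ‖z - a‖ t with hz | hz
    · have h1 : (χ • φ) =ᶠ[𝓝 z] φ := by
        have hz' : z ∈ Metric.ball a t := mem_ball_iff_norm.2 hz
        filter_upwards [Metric.isOpen_ball.mem_nhds hz'] with w hw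
        simp [hχ1 (Metric.ball_subset_closedBall hw)]
      rw [leviForm_congr h1]
      have h2 : 0 ≤ leviForm (barrier a s) z ξ :=
        le_trans (by positivity) (le_leviForm_barrier a s z ξ)
      exact add_nonneg (hφΓ z (mem_closedBall_iff_norm.2 (hz.le.trans htr.le)) ξ hξ)
        (mul_nonneg hC0 h2)
    · linarith [(abs_le.1 (hM z ξ)).1, hC z ξ hz]
  · simp [hχ1 (Metric.closedBall_subset_closedBall hst.le hz), barrier_eq_zero hz]

end Barrier

/-! ### Positive functionals on spaces of continuous functions -/

section Functionals

variable {S : Type*} [TopologicalSpace S] [CompactSpace S]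

/-- A consequence of the Riesz extension theorem: a linear form `L` on `E` that is non-negative on
the vectors with non-negative image in `C(S, ℝ)` factors through a positive linear form on
`C(S, ℝ)`. -/
theorem exists_positive_extension {E : Type*} [AddCommGroup E] [Module ℝ E]
    (Φ : E →ₗ[ℝ] C(S, ℝ)) (L : E →ₗ[ℝ] ℝ) (e₁ : E) (he₁ : Φ e₁ = 1)
    (hL : ∀ e, 0 ≤ Φ e → 0 ≤ L e) :
    ∃ Λ : C(S, ℝ) →ₗ[ℝ] ℝ, (∀ f, 0 ≤ f → 0 ≤ Λ f) ∧ ∀ e, Λ (Φ e) = L e := by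
  -- `L` vanishes on the kernel of `Φ`, so that it can be transported by any section of `Φ`.
  obtain ⟨σ, hσ⟩ := Φ.rangeRestrict.exists_rightInverse_of_surjective Φ.range_rangeRestrict
  have hσ' : ∀ y : LinearMap.range Φ, Φ (σ y) = y := fun y =>
    congrArg Subtype.val (LinearMap.congr_fun hσ y)
  let f : C(S, ℝ) →ₗ.[ℝ] ℝ := ⟨LinearMap.range Φ, L ∘ₗ σ⟩
  let P : PointedCone ℝ C(S, ℝ) :=
    { carrier := {f | 0 ≤ f}
      add_mem' := fun {f g} (hf : 0 ≤ f) (hg : 0 ≤ g) => add_nonneg hf hg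
      zero_mem' := le_refl (0 : C(S, ℝ))
      smul_mem' := fun c f hf x => mul_nonneg c.2 (hf x) }
  obtain ⟨Λ, hΛf, hΛ⟩ := riesz_extension P f
    (fun y hy => hL _ (by rw [hσ']; exact hy))
    (fun y => by
      refine ⟨⟨‖y‖ • 1, ‖y‖ • e₁, by rw [map_smul, he₁]⟩, fun x => ?_⟩
      have h := neg_le_of_abs_le (y.norm_coe_le_norm x)
      simp
      linarith)
  refine ⟨Λ, hΛ, fun e => ?_⟩
  have h1 : Λ (Φ e) = L (σ ⟨Φ e, e, rfl⟩) := hΛf ⟨Φ e, e, rfl⟩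
  have h2 : Φ (σ ⟨Φ e, e, rfl⟩) = Φ e := hσ' _
  have h3 := hL (σ ⟨Φ e, e, rfl⟩ - e) (by rw [map_sub, h2, sub_self])
  have h4 := hL (e - σ ⟨Φ e, e, rfl⟩) (by rw [map_sub, h2, sub_self])
  rw [map_sub] at h3 h4
  linarith

theorem abs_le_of_positive {Λ : C(S, ℝ) →ₗ[ℝ] ℝ} (hΛ : ∀ f, 0 ≤ f → 0 ≤ Λ f) (f : C(S, ℝ)) :
    |Λ f| ≤ Λ 1 * ‖f‖ := by
  have h1 := hΛ (‖f‖ • 1 - f) fun x => by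
    simpa using (le_abs_self _).trans (f.norm_coe_le_norm x)
  have h2 := hΛ (‖f‖ • 1 + f) fun x => by
    have h := neg_le_of_abs_le (f.norm_coe_le_norm x)
    simp
    linarith
  rw [map_sub, map_smul, smul_eq_mul] at h1
  rw [map_add, map_smul, smul_eq_mul] at h2
  rw [abs_le]
  constructor <;> linarith

/-- The real part of a complex continuous function. -/
def reMap (f : C(S, ℂ)) : C(S, ℝ) := ⟨fun x => (f x).re, by fun_prop⟩

/-- The imaginary part of a complex continuous function. -/
def imMap (f : C(S, ℂ)) : C(S, ℝ) := ⟨fun x => (f x).im, by fun_prop⟩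

/-- A positive linear form on `C(S, ℝ)` is continuous, and so is its complexification. -/
theorem exists_complexification {Λ : C(S, ℝ) →ₗ[ℝ] ℝ} (hΛ : ∀ f, 0 ≤ f → 0 ≤ Λ f) :
    ∃ Λc : C(S, ℂ) →L[ℂ] ℂ, ∀ f, Λc f = Λ (reMap f) + Λ (imMap f) * I := by
  have hadd : ∀ f g : C(S, ℂ), reMap (f + g) = reMap f + reMap g ∧
      imMap (f + g) = imMap f + imMap g := fun f g =>
    ⟨ContinuousMap.ext fun x => add_re _ _, ContinuousMap.ext fun x => add_im _ _⟩
  have hsmul : ∀ (c : ℂ) (f : C(S, ℂ)), reMap (c • f) = c.re • reMap f - c.im • imMap f ∧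
      imMap (c • f) = c.re • imMap f + c.im • reMap f := fun c f =>
    ⟨ContinuousMap.ext fun x => mul_re _ _, ContinuousMap.ext fun x => mul_im _ _⟩
  let Λ₀ : C(S, ℂ) →ₗ[ℂ] ℂ :=
    { toFun := fun f => Λ (reMap f) + Λ (imMap f) * I
      map_add' := fun f g => by
        simp only [hadd, map_add, ofReal_add]
        ring
      map_smul' := fun c f => by
        simp only [hsmul, map_add, map_sub, map_smul, smul_eq_mul, RingHom.id_apply, ofReal_add,
          ofReal_sub, ofReal_mul]
        linear_combination (Λ (reMap f) + Λ (imMap f) * I) * re_add_im c -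
          c.im * Λ (imMap f) * I_sq }
  refine ⟨Λ₀.mkContinuous (2 * Λ 1) fun f => ?_, fun f => rfl⟩
  have hΛ1 : 0 ≤ Λ 1 := hΛ 1 fun x => zero_le_one
  have h1 : ‖reMap f‖ ≤ ‖f‖ := (ContinuousMap.norm_le _ (norm_nonneg f)).2 fun x =>
    (abs_re_le_norm (f x)).trans (f.norm_coe_le_norm x)
  have h2 : ‖imMap f‖ ≤ ‖f‖ := (ContinuousMap.norm_le _ (norm_nonneg f)).2 fun x =>
    (abs_im_le_norm (f x)).trans (f.norm_coe_le_norm x)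
  calc ‖(Λ (reMap f) : ℂ) + Λ (imMap f) * I‖ ≤ |Λ (reMap f)| + |Λ (imMap f)| := by
        refine (norm_add_le _ _).trans_eq ?_
        simp
    _ ≤ Λ 1 * ‖f‖ + Λ 1 * ‖f‖ := add_le_add
        ((abs_le_of_positive hΛ _).trans (mul_le_mul_of_nonneg_left h1 hΛ1))
        ((abs_le_of_positive hΛ _).trans (mul_le_mul_of_nonneg_left h2 hΛ1))
    _ = 2 * Λ 1 * ‖f‖ := by ring

end Functionals

/-! ### Currents and their supports -/

section Currents

variable {k : ℕ}

/-- A distribution of order zero vanishes on the complement of its support, by a partition of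
unity: continuous cutoff functions suffice, since they preserve continuous test functions. -/
theorem isVanishingOn_compl_dsupport {E F : Type*} [NormedAddCommGroup E] [NormedSpace ℝ E]
    [ProperSpace E] [NormedAddCommGroup F] [NormedSpace ℝ F] [NormedSpace ℂ F]
    [SMulCommClass ℝ ℂ F] (T : 𝓓^{0}((⊤ : Opens E), F) →L[ℂ] ℂ) :
    Distribution.IsVanishingOn T (Distribution.dsupport T)ᶜ := by
  intro ψ hψ
  obtain ⟨n, U, hU, hψU⟩ : ∃ (n : ℕ) (U : Fin n → Set E),
      (∀ i, Distribution.IsVanishingOn T (U i) ∧ IsOpen (U i)) ∧ tsupport ψ ⊆ ⋃ i, U i := by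
    rw [Distribution.dsupport_compl_eq, sUnion_eq_iUnion] at hψ
    obtain ⟨t, ht⟩ := ψ.hasCompactSupport.isCompact.elim_finite_subcover _ (fun s => s.2.2) hψ
    refine ⟨t.card, fun i => (t.equivFin.symm i).1.1, fun i => (t.equivFin.symm i).1.2,
      ht.trans (iUnion₂_subset fun s hs => ?_)⟩
    exact subset_iUnion_of_subset (t.equivFin ⟨s, hs⟩) (by simp)
  obtain ⟨f, hfs, hf1, -, -⟩ := exists_continuous_sum_one_of_isOpen_isCompact
    (fun i => (hU i).2) ψ.hasCompactSupport.isCompact hψU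
  let χ : Fin n → 𝓓^{0}((⊤ : Opens E), F) := fun i =>
    { toFun := fun z => f i z • ψ z
      contDiff' := contDiff_zero.2 ((f i).continuous.smul ψ.continuous)
      hasCompactSupport' := ψ.hasCompactSupport.smul_left
      tsupport_subset' := fun _ _ => trivial }
  have h1 : ψ = ∑ i, χ i := by
    ext1 z
    have h2 : (∑ i, χ i) z = ∑ i, f i z • ψ z := by
      simp [χ]
      rfl
    rw [h2, ← Finset.sum_smul]
    by_cases hz : z ∈ tsupport ψ
    · have h3 := hf1 hz
      rw [Finset.sum_apply, Pi.one_apply] at h3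
      rw [h3, one_smul]
    · rw [image_eq_zero_of_notMem_tsupport hz, smul_zero]
  rw [h1, map_sum]
  exact Finset.sum_eq_zero fun i _ => (hU i).1 _
    ((tsupport_smul_subset_left _ _).trans (hfs i))

theorem cutoff_apply (χ : 𝓓((⊤ : Opens (Cn k)), ℝ)) {ψ : Cn k → Form11 k} (hψ : Continuous ψ)
    (z : Cn k) : cutoff χ ψ hψ z = χ z • ψ z := rfl

theorem ddbarTest_apply (φ : 𝓓((⊤ : Opens (Cn k)), ℂ)) (z : Cn k) :
    ddbarTest φ z = ddbar φ z := rfl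

/-- The pairing of a current with a form does not depend on the cutoff function. -/
theorem Current.cutoff_congr (T : Current k) {ψ : Cn k → Form11 k} (hψ : Continuous ψ)
    {χ₁ χ₂ : 𝓓((⊤ : Opens (Cn k)), ℝ)} (h₁ : ∀ᶠ z in 𝓝ˢ (Distribution.dsupport T), χ₁ z = 1)
    (h₂ : ∀ᶠ z in 𝓝ˢ (Distribution.dsupport T), χ₂ z = 1) :
    T (cutoff χ₁ ψ hψ) = T (cutoff χ₂ ψ hψ) := by
  rw [← sub_eq_zero, ← map_sub]
  refine isVanishingOn_compl_dsupport T _ fun z hz hzT => ?_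
  have h : ∀ᶠ w in 𝓝 z, χ₁ w = 1 ∧ χ₂ w = 1 :=
    (h₁.and h₂).filter_mono (nhds_le_nhdsSet hzT)
  refine (notMem_tsupport_iff_eventuallyEq.2 ?_) hz
  filter_upwards [h] with w hw
  simp [cutoff_apply, hw.1, hw.2]

theorem Form11.continuous_eval {X : Type*} [TopologicalSpace X] {f : X → Form11 k} {g : X → Cn k}
    (hf : Continuous f) (hg : Continuous g) : Continuous fun x => (f x).eval (g x) := by
  unfold Form11.eval
  fun_prop

theorem norm_eval_le (b : Form11 k) (ξ : Cn k) : ‖b.eval ξ‖ ≤ k ^ 2 * ‖b‖ * ‖ξ‖ ^ 2 := by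
  have h : ∀ j l, ‖b j l * ξ j * conj (ξ l)‖ ≤ ‖b‖ * ‖ξ‖ ^ 2 := fun j l => by
    rw [norm_mul, norm_mul, RCLike.norm_conj, mul_assoc, sq]
    gcongr
    · exact (norm_le_pi_norm (b j) l).trans (norm_le_pi_norm b j)
    · exact PiLp.norm_apply_le ξ j
    · exact PiLp.norm_apply_le ξ l
  refine (norm_sum_le_of_le _ fun j _ => norm_sum_le_of_le _ fun l _ => h j l).trans_eq ?_
  simp
  ring

variable (S : Set (Cn k × Cn k))

/-- The restriction to `S` of the function `(z, ξ) ↦ ⟨ψ(z), ξ⟩` defined by a continuous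
`(1,1)`-form `ψ`. -/
def evalOn (ψ : Cn k → Form11 k) (hψ : Continuous ψ) : C(S, ℂ) :=
  ⟨fun p => (ψ p.1.1).eval p.1.2, Form11.continuous_eval
    (hψ.comp (continuous_fst.comp continuous_subtype_val))
    (continuous_snd.comp continuous_subtype_val)⟩

/-- A continuous linear form on the continuous functions on a compact set of tangent vectors
defines a current. -/
theorem exists_current [CompactSpace S] (hS : ∀ p ∈ S, ‖p.2‖ = 1) (Λ : C(S, ℂ) →L[ℂ] ℂ) :
    ∃ T : Current k, ∀ ψ, T ψ = Λ (evalOn S ψ ψ.continuous) := by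
  let A₀ : BoundedContinuousFunction (Cn k) (Form11 k) →ₗ[ℂ] C(S, ℂ) :=
    { toFun := fun ψ => evalOn S ψ ψ.continuous
      map_add' := fun ψ₁ ψ₂ => by
        ext p
        simp [evalOn, Form11.eval, add_mul, Finset.sum_add_distrib]
      map_smul' := fun c ψ => by
        ext p
        simp [evalOn, Form11.eval, mul_assoc, Finset.mul_sum] }
  let A := A₀.mkContinuous (k ^ 2) fun ψ => by
    refine (ContinuousMap.norm_le _ (by positivity)).2 fun p => ?_
    refine (norm_eval_le (ψ p.1.1) p.1.2).trans ?_
    rw [hS p.1 p.2, one_pow, mul_one]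
    gcongr
    exact ψ.norm_coe_le_norm _
  exact ⟨(Λ.comp A).comp (TestFunction.toBoundedContinuousFunctionCLM ℂ), fun ψ => rfl⟩

end Currents

/-! ### The current of a Jensen measure -/

section Jensen

variable {k : ℕ}

/-- The vectors of length one in the cones `Γ_z`, for `z` in a closed ball. -/
def unitCone (Γ : ConeField k) (a : Cn k) (r : ℝ) : Set (Cn k × Cn k) :=
  {p | p.1 ∈ Metric.closedBall a r ∧ p.2 ∈ Γ.cone p.1 ∧ ‖p.2‖ = 1}

theorem isCompact_unitCone (Γ : ConeField k) (a : Cn k) (r : ℝ) : IsCompact (unitCone Γ a r) := by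
  refine ((isCompact_closedBall a r).prod (isCompact_sphere (0 : Cn k) 1)).of_isClosed_subset ?_
    fun p hp => ⟨hp.1, mem_sphere_zero_iff_norm.2 hp.2.2⟩
  exact (Metric.isClosed_closedBall.preimage continuous_fst).inter
    (Γ.isClosed_total.inter (isClosed_eq continuous_snd.norm continuous_const))

/-- The space of real functions of class `C²` on `ℂ^k`. -/
def C2 (k : ℕ) : Submodule ℝ (Cn k → ℝ) where
  carrier := {u | ContDiff ℝ 2 u}
  add_mem' := fun {u v} (hu : ContDiff ℝ 2 u) (hv : ContDiff ℝ 2 v) => hu.add hv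
  zero_mem' := show ContDiff ℝ 2 fun _ : Cn k => (0 : ℝ) from contDiff_const
  smul_mem' := fun c u (hu : ContDiff ℝ 2 u) => hu.const_smul c

theorem mem_C2 {u : Cn k → ℝ} : u ∈ C2 k ↔ ContDiff ℝ 2 u := Iff.rfl

/-- The Levi form as a linear map from the functions of class `C²` to the continuous functions on a
set of tangent vectors. -/
def leviOn (S : Set (Cn k × Cn k)) : C2 k →ₗ[ℝ] C(S, ℝ) where
  toFun u := ⟨fun p => leviForm u.1 p.1.1 p.1.2,
    (continuous_leviForm u.2).comp continuous_subtype_val⟩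
  map_add' u v := ContinuousMap.ext fun _ => leviForm_add u.2 v.2 _ _
  map_smul' c u := ContinuousMap.ext fun _ => leviForm_const_smul c u.2 _ _

theorem IsJensenMeasure.ae_mem {Γ : ConeField k} {K : Set (Cn k)} {x : Cn k}
    {μ : Measure (Cn k)} (hμ : IsJensenMeasure Γ K x μ) : ∀ᵐ z ∂μ, z ∈ K :=
  hμ.carried

theorem IsJensenMeasure.integrable {Γ : ConeField k} {K : Set (Cn k)} {x : Cn k}
    {μ : Measure (Cn k)} (hμ : IsJensenMeasure Γ K x μ) (hK : IsCompact K) {F : Type*}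
    [NormedAddCommGroup F] {f : Cn k → F} (hf : Continuous f) : Integrable f μ := by
  have := hμ.isProbability
  have h := hf.continuousOn.integrableOn_compact (μ := μ) hK
  rwa [IntegrableOn, Measure.restrict_eq_self_of_ae_mem hμ.ae_mem] at h

/-- The linear form `u ↦ ∫ u dμ - u(x)` on the functions of class `C²`. -/
def jensenGap {Γ : ConeField k} {K : Set (Cn k)} {x : Cn k} {μ : Measure (Cn k)}
    (hμ : IsJensenMeasure Γ K x μ) (hK : IsCompact K) : C2 k →ₗ[ℝ] ℝ where
  toFun u := ∫ z, u.1 z ∂μ - u.1 x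
  map_add' u v := by
    have h : ∫ z, (u.1 z + v.1 z) ∂μ = ∫ z, u.1 z ∂μ + ∫ z, v.1 z ∂μ :=
      integral_add (hμ.integrable hK (mem_C2.1 u.2).continuous)
        (hμ.integrable hK (mem_C2.1 v.2).continuous)
    exact (congrArg (· - (u.1 x + v.1 x)) h).trans (by ring)
  map_smul' c u := by
    have h : ∫ z, c * u.1 z ∂μ = c * ∫ z, u.1 z ∂μ := integral_const_mul c _
    exact (congrArg (· - c * u.1 x) h).trans (mul_sub _ _ _).symm

theorem norm_sub_sq_mem_PSH (Γ : ConeField k) (a : Cn k) :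
    (fun w : Cn k => ‖w - a‖ ^ 2) ∈ PSH Γ :=
  mem_PSH_iff.2 ⟨contDiff_norm_sub_sq a, fun z ξ _ => by
    rw [leviForm_norm_sub_sq]
    positivity⟩

/-- The hull of a set contained in a ball is contained in that ball. -/
theorem hull_subset_closedBall {Γ : ConeField k} {K : Set (Cn k)} (hK : K.Nonempty) {a : Cn k}
    {s : ℝ} (hs : 0 ≤ s) (hKs : K ⊆ Metric.closedBall a s) :
    hull Γ K ⊆ Metric.closedBall a s := by
  intro x hx
  have h1 : ‖x - a‖ ^ 2 ≤ s ^ 2 := (hx _ (norm_sub_sq_mem_PSH Γ a)).trans <|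
    csSup_le (hK.image _) <| by
      rintro _ ⟨z, hz, rfl⟩
      exact pow_le_pow_left₀ (norm_nonneg _) (mem_closedBall_iff_norm.1 (hKs hz)) 2
  exact mem_closedBall_iff_norm.2 (abs_le_of_sq_le_sq' h1 hs).2

/-- The Jensen inequality extends to functions that are only plurisubharmonic in the directions of
`Γ` over the ball: on `K ∪ {x}` they agree with elements of `𝒫_Γ`. -/
theorem jensenGap_nonneg {Γ : ConeField k} {K : Set (Cn k)} (hK : IsCompact K) {a : Cn k} {r : ℝ}
    (hKB : K ⊆ Metric.ball a r) {x : Cn k} (hx : x ∈ hull Γ K) {μ : Measure (Cn k)}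
    (hμ : IsJensenMeasure Γ K x μ) {u : C2 k} (hu : 0 ≤ leviOn (unitCone Γ a r) u) :
    0 ≤ jensenGap hμ hK u := by
  have := hμ.isProbability
  have hne : K.Nonempty := hμ.ae_mem.exists
  have hr : 0 < r := Metric.nonempty_ball.1 (hne.mono hKB)
  obtain ⟨s, hs, hKs⟩ := exists_pos_lt_subset_ball hr hK.isClosed hKB
  have hKs' : K ⊆ Metric.closedBall a s := hKs.trans Metric.ball_subset_closedBall
  have hlevi : ∀ z ∈ Metric.closedBall a r, ∀ ξ ∈ Γ.cone z, 0 ≤ leviForm u.1 z ξ := by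
    intro z hz ξ hξ
    rcases eq_or_ne ξ 0 with rfl | hξ0
    · simp [leviForm]
    · have hpos : 0 < ‖ξ‖ := norm_pos_iff.2 hξ0
      have h1 : 0 ≤ leviForm u.1 z ((‖ξ‖⁻¹ : ℝ) • ξ) :=
        hu ⟨(z, (‖ξ‖⁻¹ : ℝ) • ξ), hz, Γ.smul_mem z ξ hξ _ (inv_pos.2 hpos), by
          rw [norm_smul, norm_inv, norm_norm, inv_mul_cancel₀ hpos.ne']⟩
      have h2 : leviForm u.1 z ((‖ξ‖⁻¹ : ℝ) • ξ) = ‖ξ‖⁻¹ ^ 2 * leviForm u.1 z ξ := by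
        simp only [leviForm, smul_comm I, map_smul, smul_apply, smul_eq_mul]
        ring
      rw [h2] at h1
      exact nonneg_of_mul_nonneg_right h1 (by positivity)
  obtain ⟨v, hv, hvu⟩ := exists_mem_PSH_eqOn_closedBall Γ a hs.1.le hs.2 u.2 hlevi
  have h1 : ∫ z, v z ∂μ = ∫ z, u.1 z ∂μ :=
    integral_congr_ae (hμ.ae_mem.mono fun z hz => hvu (hKs' hz))
  have h2 : v x = u.1 x := hvu (hull_subset_closedBall hne hs.1.le hKs' hx)
  have h3 := hμ.le_integral v hv
  rw [h1, h2] at h3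
  exact sub_nonneg.2 h3

/-- The current obtained from a positive linear form on the continuous functions on the unit vectors
of `Γ` that extends the Jensen gap. Such a current depends only on the values of a test form on
these vectors. -/
theorem exists_current_of_jensen {Γ : ConeField k} {K : Set (Cn k)} (hK : IsCompact K) {a : Cn k}
    {r : ℝ} (hKB : K ⊆ Metric.ball a r) {x : Cn k} (hx : x ∈ hull Γ K) {μ : Measure (Cn k)}
    (hμ : IsJensenMeasure Γ K x μ) :
    ∃ T : Current k,
      (∀ ψ : 𝓓^{0}((⊤ : Opens (Cn k)), Form11 k),
        (∀ p ∈ unitCone Γ a r, 0 ≤ (ψ p.1).eval p.2) → 0 ≤ T ψ) ∧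
      ∀ (ψ : 𝓓^{0}((⊤ : Opens (Cn k)), Form11 k)) (u v : C2 k),
        (∀ p ∈ unitCone Γ a r, (ψ p.1).eval p.2 =
          (leviForm u.1 p.1 p.2 : ℝ) + (leviForm v.1 p.1 p.2 : ℝ) * I) →
        T ψ = jensenGap hμ hK u + jensenGap hμ hK v * I := by
  have : CompactSpace (unitCone Γ a r) := isCompact_iff_compactSpace.1 (isCompact_unitCone Γ a r)
  obtain ⟨Λ, hΛ, hΛL⟩ := exists_positive_extension (leviOn (unitCone Γ a r)) (jensenGap hμ hK)
    ⟨fun w => ‖w - a‖ ^ 2, mem_C2.2 (contDiff_norm_sub_sq a)⟩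
    (ContinuousMap.ext fun p => (leviForm_norm_sub_sq a _ _).trans (by simp [p.2.2.2]))
    fun u hu => jensenGap_nonneg hK hKB hx hμ hu
  obtain ⟨Λc, hΛc⟩ := exists_complexification hΛ
  obtain ⟨T, hT⟩ := exists_current _ (fun p hp => hp.2.2) Λc
  refine ⟨T, fun ψ hψ => ?_, fun ψ u v hψ => ?_⟩
  · have h1 : imMap (evalOn (unitCone Γ a r) ψ ψ.continuous) = 0 :=
      ContinuousMap.ext fun p => (nonneg_iff.1 (hψ p.1 p.2)).2.symm
    have h2 : 0 ≤ reMap (evalOn (unitCone Γ a r) ψ ψ.continuous) := fun p =>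
      (nonneg_iff.1 (hψ p.1 p.2)).1
    rw [hT, hΛc, h1, map_zero, ofReal_zero, zero_mul, add_zero]
    exact zero_le_real.2 (hΛ _ h2)
  · have h1 : reMap (evalOn (unitCone Γ a r) ψ ψ.continuous) = leviOn (unitCone Γ a r) u :=
      ContinuousMap.ext fun p => (congrArg re (hψ p.1 p.2)).trans (by simp [leviOn])
    have h2 : imMap (evalOn (unitCone Γ a r) ψ ψ.continuous) = leviOn (unitCone Γ a r) v :=
      ContinuousMap.ext fun p => (congrArg im (hψ p.1 p.2)).trans (by simp [leviOn])
    rw [hT, hΛc, h1, h2, hΛL, hΛL]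

theorem exists_testFunction_eq_one (a : Cn k) {r : ℝ} (hr : 0 ≤ r) :
    ∃ χ : 𝓓((⊤ : Opens (Cn k)), ℝ), ∀ z ∈ Metric.ball a (r + 1), χ z = 1 := by
  let b : ContDiffBump a := ⟨r + 1, r + 2, by linarith, by linarith⟩
  exact ⟨⟨b, b.contDiff, b.hasCompactSupport, fun _ _ => trivial⟩,
    fun z hz => b.one_of_mem_closedBall (Metric.ball_subset_closedBall hz)⟩

theorem contDiff_re_im (φ : 𝓓((⊤ : Opens (Cn k)), ℂ)) :
    ContDiff ℝ 2 (fun z => (φ z).re) ∧ ContDiff ℝ 2 (fun z => (φ z).im) :=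
  have h : ContDiff ℝ 2 φ := φ.contDiff.of_le (WithTop.coe_le_coe.2 (le_top : (2 : ℕ∞) ≤ ⊤))
  ⟨reCLM.contDiff.comp h, imCLM.contDiff.comp h⟩

theorem eval_ddbarTest (φ : 𝓓((⊤ : Opens (Cn k)), ℂ)) (z ξ : Cn k) :
    (ddbarTest φ z).eval ξ = (leviForm (fun z => (φ z).re) z ξ : ℝ) +
      (leviForm (fun z => (φ z).im) z ξ : ℝ) * I := by
  have h : ContDiff ℝ 2 φ := φ.contDiff.of_le (WithTop.coe_le_coe.2 (le_top : (2 : ℕ∞) ≤ ⊤))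
  rw [ddbarTest_apply, eval_ddbar h, ← re_add_im (leviForm φ z ξ)]
  exact congrArg₂ (fun s t : ℝ => (s : ℂ) + t * I) (leviForm_comp_clm reCLM h z ξ).symm
    (leviForm_comp_clm imCLM h z ξ).symm

theorem eval_cutoff (χ : 𝓓((⊤ : Opens (Cn k)), ℝ)) {u : Cn k → ℝ} (hu : ContDiff ℝ 2 u)
    (z ξ : Cn k) : (cutoff χ (ddbarR u) (continuous_ddbarR hu) z).eval ξ =
      ((χ z * leviForm u z ξ : ℝ) : ℂ) := by
  rw [cutoff_apply, ofReal_mul, ← eval_ddbarR hu]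
  simp [Form11.eval, Finset.mul_sum, mul_assoc]

end Jensen

end GammaHull

end

theorem theorem3p4 {k : ℕ} (Γ : GammaHull.ConeField k) (K : Set (GammaHull.Cn k))
    (hK : IsCompact K) (a : GammaHull.Cn k) (r : ℝ) (hKB : K ⊆ Metric.ball a r)
    (x : GammaHull.Cn k) (hx : x ∈ GammaHull.hull Γ K)
    (μ : Measure (GammaHull.Cn k)) (hμ : GammaHull.IsJensenMeasure Γ K x μ) :
    ∃ T : GammaHull.Current k, T.IsDirected Γ ∧
      Distribution.dsupport T ⊆ Metric.closedBall a r ∧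
      (∀ φ : 𝓓((⊤ : Opens (GammaHull.Cn k)), ℂ), T.iddbar φ = (∫ z, φ z ∂μ) - φ x) ∧
      (∀ (φ : GammaHull.Cn k → ℝ) (hφ : φ ∈ GammaHull.PSH Γ), ∃ c : ℝ,
        T.HasPairing (GammaHull.ddbarR φ) (GammaHull.continuous_ddbarR hφ.1) (c : ℂ) ∧
        ∫ z, φ z ∂μ = φ x + c) := by
  have := hμ.isProbability
  have hr : 0 ≤ r := (Metric.nonempty_ball.1 (Set.Nonempty.mono hKB hμ.ae_mem.exists)).le
  obtain ⟨T, hpos, hrep⟩ := GammaHull.exists_current_of_jensen hK hKB hx hμ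
  have hsupp : Distribution.dsupport T ⊆ Metric.closedBall a r := fun z hz => by
    refine (Distribution.mem_dsupport_iff z).1 hz _ (fun ψ hψ => ?_) Metric.isClosed_closedBall
    -- A test form supported off the closed ball has the same values on `Γ` there as `i∂∂̄0`.
    refine (hrep ψ 0 0 fun p hp => ?_).trans (by simp)
    have h1 : ψ p.1 = 0 := image_eq_zero_of_notMem_tsupport fun h => hψ h hp.1
    rw [h1]
    simp [GammaHull.Form11.eval, GammaHull.leviForm]
  refine ⟨T, ⟨fun ψ hψ => hpos ψ fun p _ => hψ p.1 p.2, fun u hu χ hχ => hpos _ fun p hp => ?_⟩,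
    hsupp, fun φ => ?_, fun φ hφ => ?_⟩
  · rw [GammaHull.eval_cutoff χ hu.1]
    exact zero_le_real.2 (mul_nonneg (hχ _) ((GammaHull.mem_PSH_iff.1 hu).2 _ _ hp.2.1))
  · have hφ := GammaHull.contDiff_re_im φ
    refine (hrep (GammaHull.ddbarTest φ) ⟨_, GammaHull.mem_C2.2 hφ.1⟩ ⟨_, GammaHull.mem_C2.2 hφ.2⟩
      fun p _ => GammaHull.eval_ddbarTest φ p.1 p.2).trans ?_
    have h1 : ((∫ z, (φ z).re ∂μ : ℝ) : ℂ) + (∫ z, (φ z).im ∂μ : ℝ) * I = ∫ z, φ z ∂μ :=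
      integral_re_add_im (𝕜 := ℂ) (hμ.integrable hK φ.continuous)
    rw [← h1]
    conv_rhs => rw [← re_add_im (φ x)]
    simp only [GammaHull.jensenGap, LinearMap.coe_mk, AddHom.coe_mk, ofReal_sub]
    ring
  · obtain ⟨χ₀, hχ₀⟩ := GammaHull.exists_testFunction_eq_one a hr
    have hχ₀' : ∀ᶠ z in 𝓝ˢ (Distribution.dsupport T), χ₀ z = 1 :=
      Filter.mem_of_superset (Metric.isOpen_ball.mem_nhdsSet.2 (hsupp.trans
        (Metric.closedBall_subset_ball (lt_add_one r)))) hχ₀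
    refine ⟨GammaHull.jensenGap hμ hK ⟨φ, GammaHull.mem_C2.2 hφ.1⟩, ⟨(isCompact_closedBall a r).of_isClosed_subset
      Distribution.isClosed_dsupport hsupp, fun χ hχ => ?_⟩, ?_⟩
    · rw [T.cutoff_congr _ hχ hχ₀']
      refine (hrep _ ⟨φ, GammaHull.mem_C2.2 hφ.1⟩ 0 fun p hp => ?_).trans (by simp)
      rw [GammaHull.eval_cutoff χ₀ hφ.1,
        hχ₀ _ (Metric.closedBall_subset_ball (lt_add_one r) hp.1)]
      simp [GammaHull.leviForm]
    · simp [GammaHull.jensenGap]
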